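/- **Setting.** For $s>0$ and $v\in\mathbb R^n\setminus\{0\}$ let $Q_s(v)$ be the random vector with coordinates $\|v\|_2\,\mathrm{sgn}(v_i)\,\xi_i$, where $\mathrm{sgn}(0)=1$ and the $\xi_i$ are independent: with $\lambda_i=\lfloor s|v_i|/\|v\|_2\rfloor$, $\xi_i=(\lambda_i+1)/s$ with probability $s|v_i|/\|v\|_2-\lambda_i$ and $\xi_i=\lambda_i/s$ otherwise; $Q_s(0)=0$. Let $f=\frac1m\sum_{j=0}^{m-1}f_j$ with $f_j:\mathbb R^n\to\mathbb R$, $m\ge 1$, and let $K\ge 1$ processors be given, processor $i\in\{0,\dots,K-1\}$ knowing $h_i=\frac1m\sum_{\lfloor im/K\rfloor\le j<\lfloor (i+1)m/K\rfloor}f_j$. *Quantized parallel SVRG (QSVRG)* with step size $\eta$, $T$ iterations per epoch and initial point $y^{(1)}$ runs as follows. In epoch $p\ge 1$ every processor $i$ broadcasts the unquantized gradient $\nabla h_i(y^{(p)})$, and all form $\nabla f(y^{(p)})=\sum_i\nabla h_i(y^{(p)})$; then $x_1=y^{(p)}$, and for $t=1,\dots,T$ every processor $i$ draws an index $j_{i,t}$,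 uniform on the $m$ indices and independent of everything else, and broadcasts $u_{t,i}=Q_{\sqrt n}\big(\nabla f_{j_{i,t}}(x_t)-\nabla f_{j_{i,t}}(y^{(p)})+\nabla f(y^{(p)})\big)$ with fresh independent quantization randomness, and $x_{t+1}=x_t-\frac{\eta}{K}\sum_i u_{t,i}$. Finally $y^{(p+1)}=\frac1T\sum_{t=1}^T x_t$. A quantized vector is sent as the float $\|v\|_2$ followed by a code word, from a binary prefix code on $\mathbb Z^n$, of its vector of signed levels $(\mathrm{sgn}(v_i)\sqrt n\,\xi_i)_i$; an unquantized vector is sent as $n$ floats. Every float counts as $F$ bits. **Theorem.** 1. (Convergence.) There is an absolute constant $c_0>0$ such that for every $c\in(0,c_0]$ there is a constant $C>0$, depending only on $c$ and $c_0$, with the following property. Let $\ell,L>0$, let $f=\frac1m\sum f_j$ be $\ell$-strongly convex and let each $f_j$ be convex and $L$-smooth (differentiable with $L$-Lipschitz gradient); let $x^*$ be the minimizer of $f$. If $c/L\le\eta\le c_0/L$ and $T\ge C\,L/\ell$ (so that $\eta=\Theta(1/L)$ and $T=\lceil C\,L/\ell\rceil=O(L/\ell)$ is allowed), then for every $n$,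 $K\ge 1$, every $y^{(1)}\in\mathbb R^n$ and every $p\geq 1$, $$\mathbb E\big[f(y^{(p+1)})\big]-f(x^*)\le 0.9^p\big(f(y^{(1)})-f(x^*)\big).$$ 2. (Communication.) For every $n$ there is a binary prefix code on $\mathbb Z^n$ with which, for all $F$, $m$, $K$, $f_j$, $\eta$, $T$ and $y^{(1)}$, in every epoch every processor broadcasts in expectation at most $$(F+2.8\,n)(T+1)+Fn$$ bits. (The code depends only on $n$.) -/

import Mathlib

namespace QSVRG

open scoped ENNReal

/-- Euclidean space of dimension `n`. -/
abbrev Vec (n : ℕ) : Type := EuclideanSpace ℝ (Fin n)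

/-! ### Expectations and independent products of discrete laws -/

/-- `g` has a finite expectation under the discrete law `μ`. -/
def FiniteMean {α : Type} (μ : PMF α) (g : α → ℝ) : Prop :=
  Summable fun a => (μ a).toReal * g a

/-- The expectation of `g` under the discrete law `μ`. -/
noncomputable def mean {α : Type} (μ : PMF α) (g : α → ℝ) : ℝ :=
  ∑' a, (μ a).toReal * g a

theorem tsum_prod_pmf {α : Type} : ∀ {k : ℕ} (μ : Fin k → PMF α),
    ∑' x : Fin k → α, ∏ i, μ i (x i) = 1 := by
  intro k
  induction k with
  | zero =>
    intro μ
    rw [tsum_eq_single (default : Fin 0 → α) (fun b hb => absurd (Subsingleton.elim b _) hb)]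
    simp
  | succ k ih =>
    intro μ
    rw [← (Fin.consEquiv fun _ : Fin (k + 1) => α).tsum_eq, ENNReal.tsum_prod']
    simp only [Fin.consEquiv_apply, Fin.prod_univ_succ, Fin.cons_zero, Fin.cons_succ]
    simp_rw [ENNReal.tsum_mul_left, ih fun i => μ i.succ, mul_one]
    exact (μ 0).tsum_coe

/-- The joint law of `k` independent random variables, the `i`-th one with law `μ i`. -/
noncomputable def indep {α : Type} {k : ℕ} (μ : Fin k → PMF α) : PMF (Fin k → α) :=
  ⟨fun x => ∏ i, μ i (x i), by
    have h := ENNReal.summable.hasSum (f := fun x : Fin k → α => ∏ i, μ i (x i))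
    rwa [tsum_prod_pmf μ] at h⟩

/-- A coin that shows `true` with probability `q`, for `q` between `0` and `1`. -/
noncomputable def coin (q : ℝ) (h : q ≤ 1) : PMF Bool :=
  PMF.ofFintype (fun b => if b then ENNReal.ofReal q else 1 - ENNReal.ofReal q) (by
    have h1 : ENNReal.ofReal q ≤ 1 := by simpa using h
    simpa using add_tsub_cancel_of_le h1)

/-! ### Stochastic quantization -/

/-- A quantized vector: a scale `A` and signed integer levels `k`. The coordinate `k i` stands for
sign times `s ξ_i`, so that with `s` quantization levels the vector is `(A * k i / s)_i`. -/
structure Quantized (n : ℕ) where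
  scale : ℝ
  level : Fin n → ℤ

/-- The vector that a quantized message stands for. -/
noncomputable def Quantized.decode {n : ℕ} (s : ℝ) (q : Quantized n) : Vec n :=
  WithLp.toLp 2 fun i => q.scale * ((q.level i : ℝ) / s)

/-- `|v_i| s / ‖v‖`, the position of the `i`-th coordinate on the scale of levels.
It is `0` for `v = 0`. -/
noncomputable def position {n : ℕ} (s : ℝ) (v : Vec n) (i : Fin n) : ℝ :=
  |v i| / ‖v‖ * s

/-- The law of the signed level of the `i`-th coordinate: with `l = ⌊|v_i| s / ‖v‖⌋` the level is
`l + 1` with probability `|v_i| s / ‖v‖ - l` and `l` otherwise, and it carries the sign of `v_i`,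
where `0` has sign `1`. -/
noncomputable def levelLaw {n : ℕ} (s : ℝ) (v : Vec n) (i : Fin n) : PMF ℤ :=
  (coin (Int.fract (position s v i)) (Int.fract_lt_one _).le).map fun b =>
    (if v i < 0 then -1 else 1) * (⌊position s v i⌋ + if b then 1 else 0)

/-- The random quantization `Q_s(v)`: the scale is `‖v‖` and the coordinates are quantized
independently. For `v = 0` the scale and all levels are `0`. -/
noncomputable def quantize {n : ℕ} (s : ℝ) (v : Vec n) : PMF (Quantized n) :=
  (indep (levelLaw s v)).map fun k => ⟨‖v‖, k⟩

/-! ### Objective functions -/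

/-- `f` is differentiable and its gradient is `L`-Lipschitz. -/
def Smooth {n : ℕ} (L : ℝ) (f : Vec n → ℝ) : Prop :=
  Differentiable ℝ f ∧ ∀ x y, ‖gradient f x - gradient f y‖ ≤ L * ‖x - y‖

/-- `f` is differentiable and
`f x - f y ≤ ⟨∇ f x, x - y⟩ - (ℓ / 2) ‖x - y‖²` for all `x`, `y`. -/
def StronglyConvex {n : ℕ} (l : ℝ) (f : Vec n → ℝ) : Prop :=
  Differentiable ℝ f ∧
    ∀ x y, f x - f y ≤ inner ℝ (gradient f x) (x - y) - l / 2 * ‖x - y‖ ^ 2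

/-- `f = (1 / m) ∑ f_j`. -/
noncomputable def objective {n m : ℕ} (f : Fin m → Vec n → ℝ) (x : Vec n) : ℝ :=
  1 / (m : ℝ) * ∑ j, f j x

/-- The part `h_i = (1 / m) ∑_{i m / K ≤ j < (i + 1) m / K} f_j` of the objective that processor `i`
of `K` knows. The bounds are rounded down, so that the blocks partition the indices also when
`K` does not divide `m`. -/
noncomputable def localObjective {n m : ℕ} (f : Fin m → Vec n → ℝ) (K : ℕ) (i : Fin K)
    (x : Vec n) : ℝ :=
  1 / (m : ℝ) * ∑ j ∈ Finset.univ.filter fun j : Fin m =>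
    (i : ℕ) * m / K ≤ (j : ℕ) ∧ (j : ℕ) < ((i : ℕ) + 1) * m / K, f j x

/-! ### The algorithm -/

/-- The full gradient at `y`, aggregated from the local gradients that the processors broadcast. -/
noncomputable def aggregatedGradient {n m : ℕ} (f : Fin m → Vec n → ℝ) (K : ℕ) (y : Vec n) :
    Vec n :=
  ∑ i : Fin K, gradient (localObjective f K i) y

/-- The joint law of the quantized updates that the `K` processors broadcast in an iteration with
current point `x`, in an epoch that started from `y`. Independently of the others, each processor
draws a uniform index `j` and quantizes `∇ f_j x - ∇ f_j y + ∇ f y` with `s = √n`. -/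
noncomputable def updateLaw {n m : ℕ} [NeZero m] (f : Fin m → Vec n → ℝ) (K : ℕ) (y x : Vec n) :
    PMF (Fin K → Quantized n) :=
  indep fun _ => (PMF.uniformOfFintype (Fin m)).bind fun j =>
    quantize (Real.sqrt n) (gradient (f j) x - gradient (f j) y + aggregatedGradient f K y)

/-- The average of the updates that are received. -/
noncomputable def averageUpdate {n K : ℕ} (u : Fin K → Quantized n) : Vec n :=
  (1 / (K : ℝ)) • ∑ i, (u i).decode (Real.sqrt n)

/-- The law of the record of `T` iterations that start at `x`, within an epoch that started from
`y`: for each iteration, the point `x_t` and the updates that the processors broadcast. -/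
noncomputable def iterationsLaw {n m : ℕ} [NeZero m] (f : Fin m → Vec n → ℝ) (K : ℕ) (η : ℝ)
    (y : Vec n) : ℕ → Vec n → PMF (List (Vec n × (Fin K → Quantized n)))
  | 0, _ => PMF.pure []
  | T + 1, x => (updateLaw f K y x).bind fun u =>
      (iterationsLaw f K η y T (x - η • averageUpdate u)).map fun r => (x, u) :: r

/-- The record of an epoch: its starting point `y`, and for each iteration the point `x_t` and the
quantized updates of the `K` processors. -/
structure EpochRecord (n K : ℕ) where
  start : Vec n
  iterations : List (Vec n × (Fin K → Quantized n))

/-- The law of an epoch of `T` iterations that starts from `y`; its first point is `x_1 = y`. -/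
noncomputable def epochLaw {n m : ℕ} [NeZero m] (f : Fin m → Vec n → ℝ) (K : ℕ) (η : ℝ) (T : ℕ)
    (y : Vec n) : PMF (EpochRecord n K) :=
  (iterationsLaw f K η y T y).map fun r => ⟨y, r⟩

/-- The starting point `(1 / T) ∑_{t = 1}^T x_t` of the next epoch. -/
noncomputable def EpochRecord.next {n K : ℕ} (r : EpochRecord n K) : Vec n :=
  (1 / (r.iterations.length : ℝ)) • (r.iterations.map Prod.fst).sum

/-- The law of `y^{(p + 1)}`, the point reached after `p` epochs from `y^{(1)} = y₁`. -/
noncomputable def pointLaw {n m : ℕ} [NeZero m] (f : Fin m → Vec n → ℝ) (K : ℕ) (η : ℝ) (T : ℕ)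
    (y₁ : Vec n) : ℕ → PMF (Vec n)
  | 0 => PMF.pure y₁
  | p + 1 => (pointLaw f K η T y₁ p).bind fun y => (epochLaw f K η T y).map EpochRecord.next

/-- The law of the record of epoch `p + 1` in a run from `y^{(1)} = y₁`. -/
noncomputable def epochRecordLaw {n m : ℕ} [NeZero m] (f : Fin m → Vec n → ℝ) (K : ℕ) (η : ℝ)
    (T : ℕ) (y₁ : Vec n) (p : ℕ) : PMF (EpochRecord n K) :=
  (pointLaw f K η T y₁ p).bind (epochLaw f K η T)

/-! ### Communication -/

/-- A message as it is sent: some floats, and a string of bits. -/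
structure Message where
  floats : List ℝ
  bits : List Bool

/-- The number of bits of a message if a float takes `F` bits. -/
def Message.cost (F : ℕ) (w : Message) : ℕ :=
  F * w.floats.length + w.bits.length

/-- A lossless binary code for integer vectors in which no code word is a prefix of another. -/
structure PrefixCode (n : ℕ) where
  encode : (Fin n → ℤ) → List Bool
  prefix_free : ∀ k k', encode k <+: encode k' → k = k'

/-- The messages that processor `i` broadcasts in an epoch: the unquantized gradient of `h_i` at
the starting point, and then in each iteration its quantized update, sent as the scale and the code
word of the levels. -/
noncomputable def broadcasts {n m : ℕ} (c : PrefixCode n) (f : Fin m → Vec n → ℝ) (K : ℕ)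
    (i : Fin K) (r : EpochRecord n K) : List Message :=
  ⟨List.ofFn fun a => gradient (localObjective f K i) r.start a, []⟩ ::
    r.iterations.map fun e => ⟨[(e.2 i).scale], c.encode (e.2 i).level⟩

/-- The number of bits that processor `i` broadcasts in an epoch. -/
noncomputable def epochBits {n m : ℕ} (F : ℕ) (c : PrefixCode n) (f : Fin m → Vec n → ℝ) (K : ℕ)
    (i : Fin K) (r : EpochRecord n K) : ℕ :=
  ((broadcasts c f K i r).map (Message.cost F)).sum

end QSVRG

namespace QSVRG

open scoped ENNReal

/-! ### Expectations under laws of finite support -/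

section Mean

variable {α β : Type}

/-! Convergence is the SVRG potential argument with a noisier gradient estimate. With `√n` levels
the quantization is unbiased and at most doubles the second moment: each of the `n` coordinates adds
variance at most `‖v‖² / n`. The correction `-∇ f_j y + ∇ f y` has mean zero over `j`, so the update
is an unbiased estimate of `∇ f x` (`mean_inner_averageUpdate`). By cocoercivity its second moment
is at most a multiple of `L` times the suboptimality of `x` and of `y`
(`mean_norm_averageUpdate_sq_le`). Hence `‖x - xs‖²` drops in expectation by about `2η` times the
suboptimality of `x`, up to terms of order `Lη²`. Summing over an epoch
(`mean_sum_suboptimality_le`), bounding `‖y - xs‖²` by strong convexity and applying Jensen's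
inequality to the average iterate gives a contraction (`mean_epochLaw_objective_le`), which is
iterated over the epochs.

For the communication bound, an integer is coded so that its expected code length at position `x` is
at most `2 + x² / 2` (`mean_length_word_le`). The squared positions sum to at most `n`, so a vector
costs at most `2.5 n` bits in expectation, whatever the vector.

All laws have finite support, so every expectation is a finite sum. Among independent variables only
the marginals matter (`mean_indep`). -/

theorem mean_eq_sum (μ : PMF α) (g : α → ℝ) {s : Finset α} (hs : μ.support ⊆ s) :
    mean μ g = ∑ a ∈ s, (μ a).toReal * g a :=
  tsum_eq_sum fun a ha => by
    have h : μ a = 0 := (μ.apply_eq_zero_iff a).2 fun h => ha (hs h)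
    simp [h]

theorem sum_toReal_eq_one (μ : PMF α) {s : Finset α} (hs : μ.support ⊆ s) :
    ∑ a ∈ s, (μ a).toReal = 1 := by
  rw [← ENNReal.toReal_sum fun a _ => μ.apply_ne_top a]
  have h : ∑' a, μ a = ∑ a ∈ s, μ a :=
    tsum_eq_sum fun a ha => (μ.apply_eq_zero_iff a).2 fun h => ha (hs h)
  rw [← h, μ.tsum_coe, ENNReal.toReal_one]

theorem finiteMean_of_finite {μ : PMF α} (hμ : μ.support.Finite) (g : α → ℝ) :
    FiniteMean μ g :=
  summable_of_hasFiniteSupport <| hμ.subset fun a ha h => ha (by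
    have h' : μ a = 0 := by simpa using h
    simp [h'])

theorem mean_const {μ : PMF α} (hμ : μ.support.Finite) (c : ℝ) : mean μ (fun _ => c) = c := by
  rw [mean_eq_sum μ _ hμ.coe_toFinset.ge, ← Finset.sum_mul,
    sum_toReal_eq_one μ hμ.coe_toFinset.ge, one_mul]

theorem mean_add {μ : PMF α} (hμ : μ.support.Finite) (g h : α → ℝ) :
    mean μ (fun a => g a + h a) = mean μ g + mean μ h := by
  simp_rw [mean_eq_sum μ _ hμ.coe_toFinset.ge, mul_add, Finset.sum_add_distrib]

theorem mean_const_mul (μ : PMF α) (c : ℝ) (g : α → ℝ) :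
    mean μ (fun a => c * g a) = c * mean μ g := by
  simp_rw [mean, mul_left_comm _ c, tsum_mul_left]

theorem mean_sum {ι : Type} {μ : PMF α} (hμ : μ.support.Finite) (s : Finset ι)
    (g : ι → α → ℝ) : mean μ (fun a => ∑ i ∈ s, g i a) = ∑ i ∈ s, mean μ (g i) := by
  simp_rw [mean_eq_sum μ _ hμ.coe_toFinset.ge, Finset.mul_sum]
  exact Finset.sum_comm

theorem mean_mono {μ : PMF α} (hμ : μ.support.Finite) {g h : α → ℝ}
    (H : ∀ a ∈ μ.support, g a ≤ h a) : mean μ g ≤ mean μ h := by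
  simp_rw [mean_eq_sum μ _ hμ.coe_toFinset.ge]
  exact Finset.sum_le_sum fun a ha =>
    mul_le_mul_of_nonneg_left (H a (by simpa using ha)) ENNReal.toReal_nonneg

theorem mean_pure (a : α) (g : α → ℝ) : mean (PMF.pure a) g = g a := by
  rw [mean_eq_sum (s := {a}) _ _ (by simp)]
  simp

theorem finite_support_bind {μ : PMF α} {κ : α → PMF β} (hμ : μ.support.Finite)
    (hκ : ∀ a, (κ a).support.Finite) : (μ.bind κ).support.Finite := by
  rw [PMF.support_bind]
  exact hμ.biUnion fun a _ => hκ a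

theorem finite_support_pure (a : α) : (PMF.pure a).support.Finite := by
  simp

theorem finite_support_map {μ : PMF α} (hμ : μ.support.Finite) (φ : α → β) :
    (μ.map φ).support.Finite := by
  rw [PMF.support_map]
  exact hμ.image φ

theorem mean_bind {μ : PMF α} {κ : α → PMF β} (hμ : μ.support.Finite)
    (hκ : ∀ a, (κ a).support.Finite) (g : β → ℝ) :
    mean (μ.bind κ) g = mean μ fun a => mean (κ a) g := by
  classical
  set s := hμ.toFinset with hs
  have hμs : μ.support ⊆ s := hμ.coe_toFinset.ge
  set t := s.biUnion fun a => (hκ a).toFinset with ht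
  have hκt : ∀ a ∈ s, (κ a).support ⊆ t := fun a ha b hb =>
    Finset.mem_coe.2 (Finset.mem_biUnion.2 ⟨a, ha, by simpa using hb⟩)
  have hbt : (μ.bind κ).support ⊆ t := by
    rw [PMF.support_bind]
    exact Set.iUnion₂_subset fun a ha => hκt a (hμs ha)
  have hval : ∀ b, ((μ.bind κ) b).toReal = ∑ a ∈ s, (μ a).toReal * (κ a b).toReal := fun b => by
    rw [PMF.bind_apply, tsum_eq_sum (s := s), ENNReal.toReal_sum]
    · simp [ENNReal.toReal_mul]
    · exact fun a _ => ENNReal.mul_ne_top (μ.apply_ne_top a) ((κ a).apply_ne_top b)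
    · intro a ha
      simp [(μ.apply_eq_zero_iff a).2 fun h => ha (hμs h)]
  rw [mean_eq_sum _ _ hbt, mean_eq_sum _ _ hμs]
  simp_rw [hval, Finset.sum_mul]
  rw [Finset.sum_comm]
  refine Finset.sum_congr rfl fun a ha => ?_
  rw [mean_eq_sum _ _ (hκt a ha), Finset.mul_sum]
  simp_rw [mul_assoc]

theorem mean_map {μ : PMF α} (hμ : μ.support.Finite) (φ : α → β) (g : β → ℝ) :
    mean (μ.map φ) g = mean μ fun a => g (φ a) := by
  rw [PMF.map, mean_bind hμ fun a => by simp]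
  simp [mean_pure]

theorem finite_support_indep {k : ℕ} {μ : Fin k → PMF α} (hμ : ∀ i, (μ i).support.Finite) :
    (indep μ).support.Finite := by
  refine (Set.Finite.pi' hμ).subset fun x hx i => ?_
  rw [PMF.mem_support_iff] at hx ⊢
  exact fun h => hx (Finset.prod_eq_zero (Finset.mem_univ i) h)

/-- A function of one coordinate, times the product weight, is again a product over the coordinates.
The sum therefore factors, and every factor other than the `i`-th is a total mass `1`. -/
theorem mean_indep {k : ℕ} {μ : Fin k → PMF α} (hμ : ∀ i, (μ i).support.Finite) (i : Fin k)
    (g : α → ℝ) : mean (indep μ) (fun x => g (x i)) = mean (μ i) g := by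
  classical
  have hs : (indep μ).support ⊆ (Fintype.piFinset fun j => (hμ j).toFinset : Finset _) := by
    intro x hx
    rw [PMF.mem_support_iff] at hx
    simp only [Finset.mem_coe, Fintype.mem_piFinset, Set.Finite.mem_toFinset, PMF.mem_support_iff]
    exact fun j h => hx (Finset.prod_eq_zero (Finset.mem_univ j) h)
  rw [mean_eq_sum _ _ hs]
  have hterm : ∀ x : Fin k → α, ((indep μ) x).toReal * g (x i) =
      ∏ j, (μ j (x j)).toReal * (if j = i then g (x j) else 1) := fun x => by
    rw [Finset.prod_mul_distrib, Finset.prod_ite_eq' Finset.univ i fun j => g (x j),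
      if_pos (Finset.mem_univ i), ← ENNReal.toReal_prod]
    rfl
  simp_rw [hterm]
  rw [← Finset.prod_univ_sum (fun j => (hμ j).toFinset)
    (fun j a => (μ j a).toReal * (if j = i then g a else 1)), Finset.prod_eq_single i]
  · rw [mean_eq_sum _ _ (hμ i).coe_toFinset.ge]
    simp
  · intro j _ hj
    simp only [hj, if_false, mul_one]
    exact sum_toReal_eq_one _ (hμ j).coe_toFinset.ge
  · simp

theorem mean_coin {q : ℝ} (h0 : 0 ≤ q) (h : q ≤ 1) (g : Bool → ℝ) :
    mean (coin q h) g = q * g true + (1 - q) * g false := by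
  rw [mean_eq_sum (s := Finset.univ) _ _ (by rw [Finset.coe_univ]; exact Set.subset_univ _),
    Fintype.sum_bool]
  simp only [coin, PMF.ofFintype_apply, if_true, Bool.false_eq_true, if_false]
  rw [ENNReal.toReal_sub_of_le (by simpa using h) ENNReal.one_ne_top, ENNReal.toReal_ofReal h0,
    ENNReal.toReal_one]

theorem finite_support_uniform (m : ℕ) [NeZero m] :
    (PMF.uniformOfFintype (Fin m)).support.Finite :=
  Set.toFinite _

theorem mean_uniform (m : ℕ) [NeZero m] (g : Fin m → ℝ) :
    mean (PMF.uniformOfFintype (Fin m)) g = 1 / (m : ℝ) * ∑ j, g j := by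
  rw [mean_eq_sum (s := Finset.univ) _ _ (by simp), Finset.mul_sum]
  simp

end Mean

/-! ### Moments of the quantization -/

theorem finite_support_levelLaw {n : ℕ} (s : ℝ) (v : Vec n) (i : Fin n) :
    (levelLaw s v i).support.Finite :=
  finite_support_map (Set.toFinite _) _

theorem finite_support_quantize {n : ℕ} (s : ℝ) (v : Vec n) :
    (quantize s v).support.Finite :=
  finite_support_map (finite_support_indep fun i => finite_support_levelLaw s v i) _

theorem mean_levelLaw {n : ℕ} (s : ℝ) (v : Vec n) (i : Fin n) (g : ℤ → ℝ) :
    mean (levelLaw s v i) g =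
      Int.fract (position s v i) *
        g ((if v i < 0 then -1 else 1) * (⌊position s v i⌋ + 1)) +
      (1 - Int.fract (position s v i)) *
        g ((if v i < 0 then -1 else 1) * ⌊position s v i⌋) := by
  rw [levelLaw, mean_map (Set.toFinite _), mean_coin (Int.fract_nonneg _)]
  simp

theorem mean_quantize_level {n : ℕ} (s : ℝ) (v : Vec n) (i : Fin n) (g : ℝ → ℤ → ℝ) :
    mean (quantize s v) (fun q => g q.scale (q.level i)) =
      mean (levelLaw s v i) (g ‖v‖) := by
  rw [quantize, mean_map (finite_support_indep fun i => finite_support_levelLaw s v i)]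
  exact mean_indep (fun i => finite_support_levelLaw s v i) i (g ‖v‖)

theorem norm_mul_position {n : ℕ} {s : ℝ} (hs : s ≠ 0) (v : Vec n) (i : Fin n) :
    ‖v‖ * (position s v i / s) = |v i| := by
  by_cases hv : v = 0
  · simp [hv]
  · have : ‖v‖ ≠ 0 := norm_ne_zero_iff.2 hv
    rw [position]
    field_simp

theorem sum_position_sq_le {n : ℕ} (s : ℝ) (v : Vec n) :
    ∑ i, position s v i ^ 2 ≤ s ^ 2 := by
  by_cases hv : v = 0
  · simpa [hv, position] using sq_nonneg s
  · have h : ‖v‖ ≠ 0 := norm_ne_zero_iff.2 hv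
    simp_rw [position, mul_pow, div_pow, sq_abs]
    rw [← Finset.sum_mul, ← Finset.sum_div, ← EuclideanSpace.real_norm_sq_eq, div_self (by positivity),
      one_mul]

theorem mean_quantize_coord {n : ℕ} {s : ℝ} (hs : s ≠ 0) (v : Vec n) (i : Fin n) :
    mean (quantize s v) (fun q => q.decode s i) = v i := by
  have h := mean_quantize_level s v i fun A k => A * ((k : ℝ) / s)
  refine h.trans ?_
  rw [mean_levelLaw]
  have hp := norm_mul_position hs v i
  have hf := Int.floor_add_fract (position s v i)
  split_ifs with hv
  · rw [abs_of_neg hv] at hp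
    push_cast
    rw [← neg_eq_iff_eq_neg] at hp
    rw [← hp]
    -- The first four occurrences of the position sit inside `Int.fract` and floors; the fifth is
    -- the bare one on the right-hand side.
    nth_rw 5 [← hf]
    ring
  · rw [abs_of_nonneg (not_lt.1 hv)] at hp
    push_cast
    rw [← hp]
    nth_rw 5 [← hf]
    ring

/-- A two-point law on `a`, `a + 1` with mean `a + r` has variance `r (1 - r)`; the crude bound `1`
is enough. -/
theorem mean_quantize_coord_sq_le {n : ℕ} {s : ℝ} (hs : s ≠ 0) (v : Vec n) (i : Fin n) :
    mean (quantize s v) (fun q => q.decode s i ^ 2) ≤ v i ^ 2 + ‖v‖ ^ 2 / s ^ 2 := by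
  have h := mean_quantize_level s v i fun A k => (A * ((k : ℝ) / s)) ^ 2
  refine h.trans_le ?_
  rw [mean_levelLaw]
  have hp := norm_mul_position hs v i
  have hf := Int.floor_add_fract (position s v i)
  have h0 := Int.fract_nonneg (position s v i)
  have h1 := (Int.fract_lt_one (position s v i)).le
  have hsgn : ∀ k : ℤ, (((((if v i < 0 then -1 else 1) * k : ℤ)) : ℝ)) ^ 2 = (k : ℝ) ^ 2 := by
    intro k
    split_ifs <;> simp
  simp_rw [mul_pow, div_pow, hsgn]
  rw [← sq_abs (v i), ← hp, mul_pow, div_pow]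
  push_cast
  set a : ℝ := ((⌊position s v i⌋ : ℤ) : ℝ)
  set r := Int.fract (position s v i)
  have key : r * (a + 1) ^ 2 + (1 - r) * a ^ 2 ≤ (a + r) ^ 2 + 1 := by nlinarith
  have hA : 0 ≤ ‖v‖ ^ 2 / s ^ 2 := by positivity
  calc _ = ‖v‖ ^ 2 / s ^ 2 * (r * (a + 1) ^ 2 + (1 - r) * a ^ 2) := by ring
    _ ≤ ‖v‖ ^ 2 / s ^ 2 * ((a + r) ^ 2 + 1) := mul_le_mul_of_nonneg_left key hA
    _ = _ := by rw [hf]; ring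

/-! ### The prefix code -/

/-- The code word of an integer: two bits for `0`, `1` and `-1`, and a header, a sign and a unary
number for the others. -/
def word (k : ℤ) : List Bool :=
  if k = 0 then [false, false]
  else if k = 1 then [false, true]
  else if k = -1 then [true, false]
  else true :: true :: decide (k < 0) :: (List.replicate (k.natAbs - 2) true ++ [false])

theorem replicate_true_append_false_prefix {a b : ℕ} {x y : List Bool}
    (h : List.replicate a true ++ false :: x <+: List.replicate b true ++ false :: y) :
    a = b ∧ x <+: y := by
  induction a generalizing b with
  | zero =>
    cases b with
    | zero => simpa using h
    | succ b => simp [List.replicate_succ] at h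
  | succ a ih =>
    cases b with
    | zero => simp [List.replicate_succ] at h
    | succ b =>
      simp only [List.replicate_succ, List.cons_append, List.cons_prefix_cons, true_and] at h
      exact ⟨congrArg _ (ih h).1, (ih h).2⟩

/-- Each word is self-delimiting: its first two bits decide the case, and the unary part ends at its
first `false`. The arbitrary tails make the statement fit for decoding a concatenation coordinate by
coordinate. -/
theorem word_append_prefix {k k' : ℤ} {x y : List Bool} (h : word k ++ x <+: word k' ++ y) :
    k = k' ∧ x <+: y := by
  unfold word at h
  split_ifs at h <;> simp_all [List.cons_prefix_cons]
  obtain ⟨hs, h⟩ := h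
  obtain ⟨hn, h⟩ := replicate_true_append_false_prefix h
  -- In this case `|k|` and `|k'|` are at least `2`, so the truncated subtraction of `2` loses
  -- nothing, and equal signs finish.
  exact ⟨by omega, h⟩

theorem flatten_ofFn_word_prefix {n : ℕ} {k k' : Fin n → ℤ}
    (h : (List.ofFn fun i => word (k i)).flatten <+: (List.ofFn fun i => word (k' i)).flatten) :
    k = k' := by
  induction n with
  | zero => exact Subsingleton.elim _ _
  | succ n ih =>
    simp only [List.ofFn_succ, List.flatten_cons] at h
    obtain ⟨h0, h⟩ := word_append_prefix h
    have h1 := ih h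
    funext i
    exact Fin.cases h0 (fun j => congrFun h1 j) i

/-- The code that concatenates the code words of the coordinates. -/
def wordCode (n : ℕ) : PrefixCode n where
  encode k := (List.ofFn fun i => word (k i)).flatten
  prefix_free _ _ := flatten_ofFn_word_prefix

theorem length_wordCode {n : ℕ} (k : Fin n → ℤ) :
    ((wordCode n).encode k).length = ∑ i, (word (k i)).length := by
  simp [wordCode, List.length_flatten, List.map_ofFn, List.sum_ofFn]

theorem length_word_of_natAbs_le_one {k : ℤ} (h : k.natAbs ≤ 1) : (word k).length = 2 := by
  have : k = 0 ∨ k = 1 ∨ k = -1 := by omega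
  rcases this with rfl | rfl | rfl <;> rfl

theorem length_word_of_two_le_natAbs {k : ℤ} (h : 2 ≤ k.natAbs) :
    (word k).length = k.natAbs + 2 := by
  rw [word, if_neg (by omega), if_neg (by omega), if_neg (by omega)]
  simp
  omega

/-- The left side is the piecewise linear interpolation, at the position `x`, of the word length as
a function of the absolute level. It equals `2` on `[0, 1]`, `2x` on `[1, 2]` and `x + 2` beyond.
The parabola `2 + x² / 2` lies above each piece and touches at `x = 0` and `x = 2`. -/
theorem mean_length_word_le {n : ℕ} {s : ℝ} (hs : 0 ≤ s) (v : Vec n) (i : Fin n) :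
    mean (levelLaw s v i) (fun k => ((word k).length : ℝ)) ≤ 2 + position s v i ^ 2 / 2 := by
  rw [mean_levelLaw]
  have hx : 0 ≤ position s v i := by unfold position; positivity
  have hf := Int.floor_add_fract (position s v i)
  have h0 := Int.fract_nonneg (position s v i)
  have hfl : 0 ≤ ⌊position s v i⌋ := Int.floor_nonneg.2 hx
  obtain ⟨m, hm⟩ := Int.eq_ofNat_of_zero_le hfl
  have habs : ∀ j : ℕ, ((if v i < 0 then -1 else 1) * (j : ℤ)).natAbs = j := fun j => by
    split_ifs <;> simp
  have e : ((m : ℤ) + 1) = ((m + 1 : ℕ) : ℤ) := by simp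
  rw [hm] at hf
  rw [hm, e]
  have hmx : (m : ℝ) + Int.fract (position s v i) = position s v i := by exact_mod_cast hf
  generalize Int.fract (position s v i) = r at h0 hmx ⊢
  rw [← hmx]
  match m with
  | 0 =>
    rw [length_word_of_natAbs_le_one ((habs _).trans_le (by omega)),
      length_word_of_natAbs_le_one ((habs _).trans_le (by omega))]
    push_cast
    nlinarith [sq_nonneg r]
  | 1 =>
    rw [length_word_of_two_le_natAbs (habs _).ge,
      length_word_of_natAbs_le_one (habs _).le, habs]
    push_cast
    nlinarith [sq_nonneg (1 - r)]
  | m + 2 =>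
    rw [length_word_of_two_le_natAbs (by rw [habs]; omega),
      length_word_of_two_le_natAbs (by rw [habs]; omega), habs, habs]
    push_cast
    have : (0 : ℝ) ≤ m := m.cast_nonneg
    nlinarith [sq_nonneg ((m : ℝ) + r), mul_nonneg this h0]

theorem mean_length_wordCode_quantize_le {n : ℕ} (v : Vec n) :
    mean (quantize (Real.sqrt n) v) (fun q => (((wordCode n).encode q.level).length : ℝ))
      ≤ 2.5 * n := by
  simp_rw [length_wordCode, Nat.cast_sum]
  rw [mean_sum (finite_support_quantize _ _)]
  have h : ∀ i, mean (quantize (Real.sqrt n) v) (fun q => ((word (q.level i)).length : ℝ)) ≤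
      2 + position (Real.sqrt n) v i ^ 2 / 2 := fun i =>
    (mean_quantize_level _ v i fun _ k => ((word k).length : ℝ)).trans_le
      (mean_length_word_le (Real.sqrt_nonneg _) v i)
  refine (Finset.sum_le_sum fun i _ => h i).trans ?_
  have hp := sum_position_sq_le (Real.sqrt n) v
  rw [Real.sq_sqrt n.cast_nonneg] at hp
  rw [Finset.sum_add_distrib, ← Finset.sum_div]
  simp only [Finset.sum_const, Finset.card_univ, Fintype.card_fin, nsmul_eq_mul]
  linarith

/-! ### Finiteness of the laws of the algorithm -/

section Laws

variable {n m : ℕ} [NeZero m] (f : Fin m → Vec n → ℝ) (K : ℕ) (η : ℝ) (T : ℕ)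

/-- The law of the quantized update of one processor. -/
noncomputable def processorLaw (y x : Vec n) : PMF (Quantized n) :=
  (PMF.uniformOfFintype (Fin m)).bind fun j =>
    quantize (Real.sqrt n) (gradient (f j) x - gradient (f j) y + aggregatedGradient f K y)

theorem finite_support_processorLaw (y x : Vec n) : (processorLaw f K y x).support.Finite :=
  finite_support_bind (finite_support_uniform m) fun _ => finite_support_quantize _ _

theorem mean_processorLaw (y x : Vec n) (g : Quantized n → ℝ) :
    mean (processorLaw f K y x) g = 1 / (m : ℝ) * ∑ j, mean (quantize (Real.sqrt n)
      (gradient (f j) x - gradient (f j) y + aggregatedGradient f K y)) g := by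
  rw [processorLaw, mean_bind (finite_support_uniform m) fun _ => finite_support_quantize _ _,
    mean_uniform]

theorem finite_support_updateLaw (y x : Vec n) : (updateLaw f K y x).support.Finite :=
  finite_support_indep fun _ => finite_support_processorLaw f K y x

theorem mean_updateLaw (y x : Vec n) (i : Fin K) (g : Quantized n → ℝ) :
    mean (updateLaw f K y x) (fun u => g (u i)) = mean (processorLaw f K y x) g :=
  mean_indep (fun _ => finite_support_processorLaw f K y x) i g

theorem finite_support_iterationsLaw (y x : Vec n) :
    (iterationsLaw f K η y T x).support.Finite := by
  induction T generalizing x with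
  | zero => exact finite_support_pure _
  | succ T ih =>
    exact finite_support_bind (finite_support_updateLaw f K y x) fun u =>
      finite_support_map (ih _) _

theorem mean_iterationsLaw_succ (y x : Vec n)
    (g : List (Vec n × (Fin K → Quantized n)) → ℝ) :
    mean (iterationsLaw f K η y (T + 1) x) g = mean (updateLaw f K y x) fun u =>
      mean (iterationsLaw f K η y T (x - η • averageUpdate u)) fun r => g ((x, u) :: r) := by
  have hT := finite_support_iterationsLaw f K η T y
  rw [iterationsLaw, mean_bind (finite_support_updateLaw f K y x) fun u =>
    finite_support_map (hT _) _]
  simp_rw [mean_map (hT _)]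

theorem finite_support_epochLaw (y : Vec n) : (epochLaw f K η T y).support.Finite :=
  finite_support_map (finite_support_iterationsLaw f K η T y y) _

theorem mean_epochLaw (y : Vec n) (g : EpochRecord n K → ℝ) :
    mean (epochLaw f K η T y) g = mean (iterationsLaw f K η y T y) fun r => g ⟨y, r⟩ :=
  mean_map (finite_support_iterationsLaw f K η T y y) _ _

theorem finite_support_pointLaw (y₁ : Vec n) (p : ℕ) :
    (pointLaw f K η T y₁ p).support.Finite := by
  induction p with
  | zero => exact finite_support_pure _
  | succ p ih =>
    exact finite_support_bind ih fun y => finite_support_map (finite_support_epochLaw f K η T y) _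

theorem finite_support_epochRecordLaw (y₁ : Vec n) (p : ℕ) :
    (epochRecordLaw f K η T y₁ p).support.Finite :=
  finite_support_bind (finite_support_pointLaw f K η T y₁ p) (finite_support_epochLaw f K η T)

/-! ### Communication -/

theorem mean_length_update_le (i : Fin K) (y x : Vec n) :
    mean (updateLaw f K y x) (fun u => (((wordCode n).encode (u i).level).length : ℝ))
      ≤ 2.5 * n := by
  rw [mean_updateLaw f K y x i fun q => (((wordCode n).encode q.level).length : ℝ),
    mean_processorLaw]
  have hm : (m : ℝ) ≠ 0 := Nat.cast_ne_zero.2 (NeZero.ne m)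
  calc _ ≤ 1 / (m : ℝ) * ∑ _j : Fin m, 2.5 * (n : ℝ) :=
        mul_le_mul_of_nonneg_left (Finset.sum_le_sum fun j _ =>
          mean_length_wordCode_quantize_le _) (by positivity)
    _ = 2.5 * n := by
        rw [Finset.sum_const, Finset.card_univ, Fintype.card_fin, nsmul_eq_mul]
        field_simp

theorem mean_iterationsBits_le (F : ℕ) (i : Fin K) (y x : Vec n) :
    mean (iterationsLaw f K η y T x) (fun r => (((r.map fun e =>
      F + ((wordCode n).encode (e.2 i).level).length).sum : ℕ) : ℝ)) ≤ T * (F + 2.5 * n) := by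
  induction T generalizing x with
  | zero => simp [iterationsLaw, mean_pure]
  | succ T ih =>
    rw [mean_iterationsLaw_succ]
    simp only [List.map_cons, List.sum_cons, Nat.cast_add]
    have hu := finite_support_updateLaw f K y x
    have hT := finite_support_iterationsLaw f K η T y
    simp_rw [mean_add (hT _), mean_const (hT _)]
    rw [mean_add hu, mean_add hu, mean_const hu]
    have h2 := mean_length_update_le f K i y x
    have h3 := (mean_mono hu fun u _ => ih (x - η • averageUpdate u)).trans_eq (mean_const hu _)
    push_cast at h3 ⊢
    linarith

theorem mean_epochBits_le (F : ℕ) (y₁ : Vec n) (p : ℕ) (i : Fin K) :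
    mean (epochRecordLaw f K η T y₁ p) (fun r => (epochBits F (wordCode n) f K i r : ℝ))
      ≤ F * n + T * (F + 2.5 * n) := by
  have hp := finite_support_pointLaw f K η T y₁ p
  rw [epochRecordLaw, mean_bind hp (finite_support_epochLaw f K η T)]
  refine (mean_mono hp fun y _ => ?_).trans_eq (mean_const hp _)
  rw [mean_epochLaw]
  have hbits : ∀ r, (epochBits F (wordCode n) f K i ⟨y, r⟩ : ℝ) = F * n + (((r.map fun e =>
      F + ((wordCode n).encode (e.2 i).level).length).sum : ℕ) : ℝ) := fun r => by
    simp [epochBits, broadcasts, Message.cost, Function.comp_def]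
  simp_rw [hbits]
  have hT := finite_support_iterationsLaw f K η T y y
  rw [mean_add hT, mean_const hT]
  exact add_le_add_right (mean_iterationsBits_le f K η T F i y y) _

end Laws

/-! ### Smooth convex functions -/

section Smooth

variable {n : ℕ} {φ : Vec n → ℝ}

theorem hasDerivAt_lineMap (hφ : Differentiable ℝ φ) (x z : Vec n) (t : ℝ) :
    HasDerivAt (fun t => φ (AffineMap.lineMap x z t))
      (inner ℝ (gradient φ (AffineMap.lineMap x z t)) (z - x)) t :=
  (hφ _).hasGradientAt.hasFDerivAt.comp_hasDerivAt t AffineMap.hasDerivAt_lineMap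

theorem add_inner_gradient_le (hc : ConvexOn ℝ Set.univ φ) (hφ : Differentiable ℝ φ)
    (z x : Vec n) : φ z + inner ℝ (gradient φ z) (x - z) ≤ φ x := by
  have h := (hc.comp_affineMap (AffineMap.lineMap (k := ℝ) z x)).le_slope_of_hasDerivAt
    (Set.mem_univ 0) (Set.mem_univ 1) one_pos (hasDerivAt_lineMap hφ z x 0)
  simp only [slope_def_field, Function.comp_apply, AffineMap.lineMap_apply_zero,
    AffineMap.lineMap_apply_one, sub_zero, div_one] at h
  linarith

/-- The mean value theorem on the segment replaces the usual integration, at the price of `L`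
instead of `L / 2`. -/
theorem Smooth.le_add_inner_gradient {L : ℝ} (hL : 0 ≤ L) (hφ : Smooth L φ) (x w : Vec n) :
    φ w ≤ φ x + inner ℝ (gradient φ x) (w - x) + L * ‖w - x‖ ^ 2 := by
  obtain ⟨t, ⟨h0, h1⟩, ht⟩ := exists_hasDerivAt_eq_slope
    (fun t : ℝ => φ (AffineMap.lineMap x w t)) _ one_pos
    (fun t _ => (hasDerivAt_lineMap hφ.1 x w t).continuousAt.continuousWithinAt)
    fun t _ => hasDerivAt_lineMap hφ.1 x w t
  simp only [AffineMap.lineMap_apply_zero, AffineMap.lineMap_apply_one, sub_zero, div_one] at ht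
  set u : Vec n := AffineMap.lineMap x w t with hu
  have hux : ‖u - x‖ ≤ ‖w - x‖ := by
    have : u - x = t • (w - x) := by simp [hu, AffineMap.lineMap_apply]
    rw [this, norm_smul, Real.norm_of_nonneg h0.le]
    exact mul_le_of_le_one_left (norm_nonneg _) h1.le
  have h2 : inner ℝ (gradient φ u - gradient φ x) (w - x) ≤ L * ‖w - x‖ ^ 2 :=
    calc _ ≤ ‖gradient φ u - gradient φ x‖ * ‖w - x‖ := real_inner_le_norm _ _
      _ ≤ L * ‖u - x‖ * ‖w - x‖ := by gcongr; exact hφ.2 u x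
      _ ≤ L * ‖w - x‖ * ‖w - x‖ := by gcongr
      _ = _ := by ring
  rw [inner_sub_left] at h2
  linarith

/-- At the point `x - g / (2L)`, the upper bound by smoothness from `x` is compared with the lower
bound by the tangent at `z`. The step `1 / (2L)` minimizes `-t ‖g‖² + L t² ‖g‖²`, which leaves `‖g‖²
/ (4L)`. -/
theorem Smooth.norm_gradient_sub_sq_le {L : ℝ} (hL : 0 < L) (hc : ConvexOn ℝ Set.univ φ)
    (hφ : Smooth L φ) (x z : Vec n) :
    ‖gradient φ x - gradient φ z‖ ^ 2 ≤
      4 * L * (φ x - φ z - inner ℝ (gradient φ z) (x - z)) := by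
  set g := gradient φ x - gradient φ z with hg
  have h1 := hφ.le_add_inner_gradient hL.le x (x - (1 / (2 * L)) • g)
  have h2 := add_inner_gradient_le hc hφ.1 z (x - (1 / (2 * L)) • g)
  have h3 : inner ℝ (gradient φ x) g - inner ℝ (gradient φ z) g = ‖g‖ ^ 2 := by
    rw [← inner_sub_left, ← hg, real_inner_self_eq_norm_sq]
  have e1 : x - (1 / (2 * L)) • g - x = -((1 / (2 * L)) • g) := by abel
  have e2 : x - (1 / (2 * L)) • g - z = (x - z) - (1 / (2 * L)) • g := by abel
  rw [e1, inner_neg_right, real_inner_smul_right, norm_neg, norm_smul, mul_pow,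
    Real.norm_eq_abs, sq_abs] at h1
  rw [e2, inner_sub_right, real_inner_smul_right] at h2
  have e3 : 4 * L * (1 / (2 * L) * ‖g‖ ^ 2 - L * ((1 / (2 * L)) ^ 2 * ‖g‖ ^ 2)) = ‖g‖ ^ 2 := by
    field_simp
    ring
  rw [← e3]
  refine mul_le_mul_of_nonneg_left ?_ (by positivity)
  have h4 := congrArg (fun t => 1 / (2 * L) * t) h3
  simp only [mul_sub] at h4
  linarith

theorem gradient_const_mul_sum {m : ℕ} {f : Fin m → Vec n → ℝ} (hf : ∀ j, Differentiable ℝ (f j))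
    (c : ℝ) (s : Finset (Fin m)) (x : Vec n) :
    gradient (fun x => c * ∑ j ∈ s, f j x) x = c • ∑ j ∈ s, gradient (f j) x := by
  simp only [gradient]
  rw [fderiv_const_mul (DifferentiableAt.fun_sum fun j _ => hf j x),
    fderiv_fun_sum fun j _ => hf j x]
  simp [map_sum]

theorem norm_average_sq_le {E : Type*} [SeminormedAddCommGroup E] [NormedSpace ℝ E] {k : ℕ}
    (a : Fin k → E) : ‖(1 / (k : ℝ)) • ∑ i, a i‖ ^ 2 ≤ 1 / (k : ℝ) * ∑ i, ‖a i‖ ^ 2 := by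
  rcases Nat.eq_zero_or_pos k with rfl | hk
  · simp
  have hk' : (0 : ℝ) < k := Nat.cast_pos.2 hk
  have h : ‖∑ i, a i‖ ^ 2 ≤ k * ∑ i, ‖a i‖ ^ 2 :=
    (pow_le_pow_left₀ (norm_nonneg _) (norm_sum_le _ _) 2).trans
      (by simpa using sq_sum_le_card_mul_sum_sq (s := Finset.univ) (f := fun i => ‖a i‖))
  rw [norm_smul, mul_pow, Real.norm_eq_abs, sq_abs]
  calc _ ≤ (1 / (k : ℝ)) ^ 2 * (k * ∑ i, ‖a i‖ ^ 2) := by gcongr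
    _ = _ := by field_simp

theorem StronglyConvex.norm_sub_sq_le {l : ℝ} (hφ : StronglyConvex l φ) {xs : Vec n}
    (hxs : gradient φ xs = 0) (y : Vec n) : l / 2 * ‖y - xs‖ ^ 2 ≤ φ y - φ xs := by
  have h := hφ.2 xs y
  rw [hxs, inner_zero_left, norm_sub_rev] at h
  linarith

theorem StronglyConvex.sub_le_inner_gradient {l : ℝ} (hl : 0 ≤ l) (hφ : StronglyConvex l φ)
    (x y : Vec n) : φ x - φ y ≤ inner ℝ (gradient φ x) (x - y) := by
  have h := hφ.2 x y
  have : 0 ≤ l / 2 * ‖x - y‖ ^ 2 := by positivity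
  linarith

/-- Jensen's inequality for the average of a list. -/
theorem StronglyConvex.average_le {l : ℝ} (hl : 0 ≤ l) (hφ : StronglyConvex l φ)
    {r : List (Vec n)} (hr : r ≠ []) :
    r.length * φ ((1 / (r.length : ℝ)) • r.sum) ≤ (r.map φ).sum := by
  set z := (1 / (r.length : ℝ)) • r.sum with hz
  -- Tangent inequalities at the fixed point `z` are summed over an arbitrary list; the linear term
  -- vanishes for `r' = r`, because `z` is its average.
  have h : ∀ r' : List (Vec n), r'.length * φ z ≤
      (r'.map φ).sum + inner ℝ (gradient φ z) ((r'.length : ℝ) • z - r'.sum) := by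
    intro r'
    induction r' with
    | nil => simp
    | cons x r' ih =>
      have hx := hφ.sub_le_inner_gradient hl z x
      have e : ((r'.length : ℝ) + 1) • z - (x + r'.sum) =
          (z - x) + ((r'.length : ℝ) • z - r'.sum) := by
        rw [add_smul, one_smul]
        abel
      simp only [List.length_cons, List.map_cons, List.sum_cons, Nat.cast_add, Nat.cast_one]
      rw [e, inner_add_right]
      linarith
  have hlen : (r.length : ℝ) ≠ 0 := by simpa using hr
  have h0 : (r.length : ℝ) • z - r.sum = 0 := by
    rw [hz, smul_smul, mul_one_div_cancel hlen, one_smul, sub_self]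
  simpa [h0] using h r

end Smooth

/-! ### The aggregated gradient -/

/-- The first `k` blocks together are exactly the indices below `⌊k m / K⌋`, and for `k = K` these
are all indices. -/
theorem sum_sum_block {E : Type*} [AddCommMonoid E] {m K : ℕ} (hK : 0 < K) (G : Fin m → E) :
    ∑ i : Fin K, ∑ j ∈ Finset.univ.filter (fun j : Fin m =>
      (i : ℕ) * m / K ≤ (j : ℕ) ∧ (j : ℕ) < ((i : ℕ) + 1) * m / K), G j = ∑ j, G j := by
  rw [Fin.sum_univ_eq_sum_range fun i : ℕ => ∑ j ∈ Finset.univ.filter (fun j : Fin m =>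
      i * m / K ≤ (j : ℕ) ∧ (j : ℕ) < (i + 1) * m / K), G j]
  have h : ∀ k : ℕ, ∑ i ∈ Finset.range k, ∑ j ∈ Finset.univ.filter (fun j : Fin m =>
      i * m / K ≤ (j : ℕ) ∧ (j : ℕ) < (i + 1) * m / K), G j =
      ∑ j ∈ Finset.univ.filter (fun j : Fin m => (j : ℕ) < k * m / K), G j := by
    intro k
    induction k with
    | zero => simp
    | succ k ih =>
      have hk : k * m / K ≤ (k + 1) * m / K :=
        Nat.div_le_div_right (Nat.mul_le_mul_right m k.le_succ)
      rw [Finset.sum_range_succ, ih, ← Finset.sum_union]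
      · congr 1
        ext j
        simp only [Finset.mem_union, Finset.mem_filter, Finset.mem_univ, true_and]
        omega
      · refine Finset.disjoint_filter.2 fun j _ h1 h2 => ?_
        omega
  rw [h, Nat.mul_div_cancel_left m hK]
  simp

theorem gradient_objective {n m : ℕ} {f : Fin m → Vec n → ℝ} (hf : ∀ j, Differentiable ℝ (f j))
    (x : Vec n) : gradient (objective f) x = (1 / (m : ℝ)) • ∑ j, gradient (f j) x :=
  gradient_const_mul_sum hf _ _ x

theorem aggregatedGradient_eq {n m K : ℕ} (hK : 0 < K) {f : Fin m → Vec n → ℝ}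
    (hf : ∀ j, Differentiable ℝ (f j)) (y : Vec n) :
    aggregatedGradient f K y = gradient (objective f) y := by
  rw [gradient_objective hf, ← sum_sum_block hK, Finset.smul_sum]
  exact Finset.sum_congr rfl fun i _ => gradient_const_mul_sum hf _ _ y

/-! ### Moments of the updates -/

theorem mean_inner_quantize {n : ℕ} (v w : Vec n) :
    mean (quantize (Real.sqrt n) v) (fun q => inner ℝ w (q.decode (Real.sqrt n))) =
      inner ℝ w v := by
  simp_rw [PiLp.inner_apply, RCLike.inner_apply, conj_trivial]
  rw [mean_sum (finite_support_quantize _ _)]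
  refine Finset.sum_congr rfl fun i _ => ?_
  -- The existence of a coordinate `i` forces `n > 0`.
  have hn : Real.sqrt n ≠ 0 := (Real.sqrt_pos.2 (Nat.cast_pos.2 i.pos)).ne'
  simp_rw [mul_comm _ (w i)]
  rw [mean_const_mul, mean_quantize_coord hn]

theorem mean_norm_quantize_sq_le {n : ℕ} (v : Vec n) :
    mean (quantize (Real.sqrt n) v) (fun q => ‖q.decode (Real.sqrt n)‖ ^ 2) ≤ 2 * ‖v‖ ^ 2 := by
  simp_rw [EuclideanSpace.real_norm_sq_eq (Quantized.decode _ _)]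
  rw [mean_sum (finite_support_quantize _ _)]
  have h : ∀ i, mean (quantize (Real.sqrt n) v) (fun q => q.decode (Real.sqrt n) i ^ 2) ≤
      v i ^ 2 + ‖v‖ ^ 2 / n := fun i => by
    have hn : Real.sqrt n ≠ 0 := (Real.sqrt_pos.2 (Nat.cast_pos.2 i.pos)).ne'
    simpa [Real.sq_sqrt] using mean_quantize_coord_sq_le hn v i
  refine (Finset.sum_le_sum fun i _ => h i).trans ?_
  rw [Finset.sum_add_distrib, ← EuclideanSpace.real_norm_sq_eq, Finset.sum_const,
    Finset.card_univ, Fintype.card_fin, nsmul_eq_mul, two_mul]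
  gcongr
  rcases Nat.eq_zero_or_pos n with rfl | hn
  · simp
  · have : (n : ℝ) ≠ 0 := by positivity
    rw [mul_div_cancel₀ _ this]

theorem norm_sub_add_sq_le {E : Type*} [SeminormedAddCommGroup E] (a b c : E) :
    ‖a - b + c‖ ^ 2 ≤ 3 * (‖a‖ ^ 2 + ‖b‖ ^ 2 + ‖c‖ ^ 2) := by
  have h : ‖a - b + c‖ ≤ ‖a‖ + ‖b‖ + ‖c‖ :=
    (norm_add_le _ _).trans (by gcongr; exact norm_sub_le _ _)
  nlinarith [norm_nonneg (a - b + c), sq_nonneg (‖a‖ - ‖b‖), sq_nonneg (‖b‖ - ‖c‖),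
    sq_nonneg (‖a‖ - ‖c‖)]

section Convergence

variable {n m K : ℕ} {f : Fin m → Vec n → ℝ} {l L : ℝ} {xs : Vec n}

theorem gradient_eq_zero_of_forall_le {φ : Vec n → ℝ} (h : ∀ x, φ xs ≤ φ x) :
    gradient φ xs = 0 := by
  have : IsLocalMin φ xs := Filter.Eventually.of_forall h
  rw [gradient, this.fderiv_eq_zero, map_zero]

/-- Cocoercivity is averaged over `j`: the linear terms add up to the inner product with `∇ f xs`,
which is zero. -/
theorem mean_norm_gradient_sub_sq_le (hL : 0 < L) (hc : ∀ j, ConvexOn ℝ Set.univ (f j))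
    (hf : ∀ j, Smooth L (f j)) (hxs : gradient (objective f) xs = 0) (x : Vec n) :
    1 / (m : ℝ) * ∑ j, ‖gradient (f j) x - gradient (f j) xs‖ ^ 2 ≤
      4 * L * (objective f x - objective f xs) := by
  have h : ∑ j, ‖gradient (f j) x - gradient (f j) xs‖ ^ 2 ≤
      4 * L * (∑ j, f j x - ∑ j, f j xs - inner ℝ (∑ j, gradient (f j) xs) (x - xs)) := by
    rw [sum_inner, ← Finset.sum_sub_distrib, ← Finset.sum_sub_distrib, Finset.mul_sum]
    exact Finset.sum_le_sum fun j _ => (hf j).norm_gradient_sub_sq_le hL (hc j) x xs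
  rw [gradient_objective fun j => (hf j).1] at hxs
  have h0 : 1 / (m : ℝ) * inner ℝ (∑ j, gradient (f j) xs) (x - xs) = 0 := by
    rw [← real_inner_smul_left, hxs, inner_zero_left]
  refine (mul_le_mul_of_nonneg_left h (by positivity)).trans_eq ?_
  rw [objective, objective]
  linear_combination (-4 * L) * h0

theorem norm_gradient_objective_sq_le (hL : 0 < L) (hc : ∀ j, ConvexOn ℝ Set.univ (f j))
    (hf : ∀ j, Smooth L (f j)) (hxs : gradient (objective f) xs = 0) (y : Vec n) :
    ‖gradient (objective f) y‖ ^ 2 ≤ 4 * L * (objective f y - objective f xs) := by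
  have e : gradient (objective f) y =
      (1 / (m : ℝ)) • ∑ j, (gradient (f j) y - gradient (f j) xs) := by
    rw [Finset.sum_sub_distrib, smul_sub, ← gradient_objective fun j => (hf j).1,
      ← gradient_objective fun j => (hf j).1, hxs, sub_zero]
  rw [e]
  exact (norm_average_sq_le _).trans (mean_norm_gradient_sub_sq_le hL hc hf hxs y)

variable [NeZero m]

theorem average_const (c : ℝ) : 1 / (m : ℝ) * ∑ _j : Fin m, c = c := by
  have hm : (m : ℝ) ≠ 0 := Nat.cast_ne_zero.2 (NeZero.ne m)
  rw [Finset.sum_const, Finset.card_univ, Fintype.card_fin, nsmul_eq_mul]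
  field_simp

/-- The vector is split as `(∇ f_j x - ∇ f_j xs) - (∇ f_j y - ∇ f_j xs) + ∇ f y`. The factor `24 L`
is `2 · 3 · 4 L`, from quantization, three summands and cocoercivity; it occurs once for `x` and
twice for `y`. -/
theorem mean_norm_update_sq_le (hK : 0 < K) (hL : 0 < L)
    (hc : ∀ j, ConvexOn ℝ Set.univ (f j)) (hf : ∀ j, Smooth L (f j))
    (hxs : gradient (objective f) xs = 0) (y x : Vec n) :
    mean (processorLaw f K y x) (fun q => ‖q.decode (Real.sqrt n)‖ ^ 2) ≤
      24 * L * (objective f x - objective f xs) + 48 * L * (objective f y - objective f xs) := by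
  rw [mean_processorLaw, aggregatedGradient_eq hK fun j => (hf j).1]
  have hx := mean_norm_gradient_sub_sq_le hL hc hf hxs x
  have hy := mean_norm_gradient_sub_sq_le hL hc hf hxs y
  have hg := norm_gradient_objective_sq_le hL hc hf hxs y
  have hj : ∀ j, mean (quantize (Real.sqrt n)
      (gradient (f j) x - gradient (f j) y + gradient (objective f) y))
      (fun q => ‖q.decode (Real.sqrt n)‖ ^ 2) ≤
      6 * (‖gradient (f j) x - gradient (f j) xs‖ ^ 2 +
        ‖gradient (f j) y - gradient (f j) xs‖ ^ 2 + ‖gradient (objective f) y‖ ^ 2) := by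
    intro j
    have h := norm_sub_add_sq_le (gradient (f j) x - gradient (f j) xs)
      (gradient (f j) y - gradient (f j) xs) (gradient (objective f) y)
    rw [sub_sub_sub_cancel_right] at h
    refine (mean_norm_quantize_sq_le _).trans ?_
    linarith
  refine (mul_le_mul_of_nonneg_left (Finset.sum_le_sum fun j _ => hj j) (by positivity)).trans ?_
  rw [← Finset.mul_sum, Finset.sum_add_distrib, Finset.sum_add_distrib, mul_left_comm, mul_add,
    mul_add, average_const]
  linarith

theorem mean_inner_averageUpdate (hK : 0 < K) (hf : ∀ j, Differentiable ℝ (f j))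
    (y x w : Vec n) :
    mean (updateLaw f K y x) (fun u => inner ℝ w (averageUpdate u)) =
      inner ℝ w (gradient (objective f) x) := by
  have hK' : (K : ℝ) ≠ 0 := by positivity
  simp_rw [averageUpdate, real_inner_smul_right, inner_sum]
  rw [mean_const_mul, mean_sum (finite_support_updateLaw f K y x)]
  have h : ∀ i : Fin K, mean (updateLaw f K y x)
      (fun u => inner ℝ w ((u i).decode (Real.sqrt n))) =
      inner ℝ w (gradient (objective f) x) := fun i => by
    rw [mean_updateLaw f K y x i fun q => inner ℝ w (q.decode (Real.sqrt n)), mean_processorLaw,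
      aggregatedGradient_eq hK hf]
    simp_rw [mean_inner_quantize, ← inner_sum]
    rw [← real_inner_smul_right, Finset.sum_add_distrib, Finset.sum_sub_distrib, smul_add,
      smul_sub, ← gradient_objective hf, ← gradient_objective hf, Finset.sum_const,
      Finset.card_univ, Fintype.card_fin, ← Nat.cast_smul_eq_nsmul ℝ, smul_smul,
      one_div_mul_cancel (Nat.cast_ne_zero.2 (NeZero.ne m)), one_smul, sub_add_cancel]
  simp_rw [h]
  rw [Finset.sum_const, Finset.card_univ, Fintype.card_fin, nsmul_eq_mul]
  field_simp

theorem mean_norm_averageUpdate_sq_le (hK : 0 < K) (hL : 0 < L)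
    (hc : ∀ j, ConvexOn ℝ Set.univ (f j)) (hf : ∀ j, Smooth L (f j))
    (hxs : gradient (objective f) xs = 0) (y x : Vec n) :
    mean (updateLaw f K y x) (fun u => ‖averageUpdate u‖ ^ 2) ≤
      24 * L * (objective f x - objective f xs) + 48 * L * (objective f y - objective f xs) := by
  have hu := finite_support_updateLaw f K y x
  have : NeZero K := ⟨hK.ne'⟩
  refine (mean_mono hu fun u _ => norm_average_sq_le fun i =>
    (u i).decode (Real.sqrt n)).trans ?_
  rw [mean_const_mul, mean_sum hu]
  rw [← average_const (m := K) (24 * L * (objective f x - objective f xs) +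
    48 * L * (objective f y - objective f xs))]
  refine mul_le_mul_of_nonneg_left (Finset.sum_le_sum fun i _ => ?_) (by positivity)
  rw [mean_updateLaw f K y x i fun q => ‖q.decode (Real.sqrt n)‖ ^ 2]
  exact mean_norm_update_sq_le hK hL hc hf hxs y x

/-! ### Convergence -/

theorem mean_norm_step_sq_le (hK : 0 < K) (hl : 0 ≤ l) (hL : 0 < L)
    (hsc : StronglyConvex l (objective f)) (hc : ∀ j, ConvexOn ℝ Set.univ (f j))
    (hf : ∀ j, Smooth L (f j)) (hxs : gradient (objective f) xs = 0) {η : ℝ} (hη : 0 ≤ η)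
    (y x : Vec n) :
    mean (updateLaw f K y x) (fun u => ‖x - η • averageUpdate u - xs‖ ^ 2) ≤
      ‖x - xs‖ ^ 2 - (2 * η - 24 * L * η ^ 2) * (objective f x - objective f xs) +
        48 * L * η ^ 2 * (objective f y - objective f xs) := by
  have hu := finite_support_updateLaw f K y x
  have e : ∀ u : Fin K → Quantized n, ‖x - η • averageUpdate u - xs‖ ^ 2 =
      ‖x - xs‖ ^ 2 + ((-2 * η) * inner ℝ (x - xs) (averageUpdate u) +
        η ^ 2 * ‖averageUpdate u‖ ^ 2) := fun u => by
    rw [sub_right_comm, norm_sub_sq_real, real_inner_smul_right, norm_smul, mul_pow,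
      Real.norm_eq_abs, sq_abs]
    ring
  simp_rw [e]
  rw [mean_add hu, mean_const hu, mean_add hu, mean_const_mul, mean_const_mul,
    mean_inner_averageUpdate hK fun j => (hf j).1, real_inner_comm]
  have h1 := mul_le_mul_of_nonneg_left (hsc.sub_le_inner_gradient hl x xs) hη
  have h2 := mul_le_mul_of_nonneg_left (mean_norm_averageUpdate_sq_le hK hL hc hf hxs y x)
    (sq_nonneg η)
  linarith

/-- The one-step bounds telescope: `y` stays fixed, `x` moves, and the final squared distance is
dropped. -/
theorem mean_sum_suboptimality_le (hK : 0 < K) (hl : 0 ≤ l) (hL : 0 < L)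
    (hsc : StronglyConvex l (objective f)) (hc : ∀ j, ConvexOn ℝ Set.univ (f j))
    (hf : ∀ j, Smooth L (f j)) (hxs : gradient (objective f) xs = 0) {η : ℝ} (hη : 0 ≤ η)
    (y : Vec n) (T : ℕ) (x : Vec n) :
    (2 * η - 24 * L * η ^ 2) * mean (iterationsLaw f K η y T x)
        (fun r => (r.map fun e => objective f e.1 - objective f xs).sum) ≤
      ‖x - xs‖ ^ 2 + T * (48 * L * η ^ 2 * (objective f y - objective f xs)) := by
  induction T generalizing x with
  | zero => simp [iterationsLaw, mean_pure]
  | succ T ih =>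
    have hu := finite_support_updateLaw f K y x
    have hT := finite_support_iterationsLaw f K η T y
    rw [mean_iterationsLaw_succ]
    simp only [List.map_cons, List.sum_cons]
    simp_rw [mean_add (hT _), mean_const (hT _)]
    rw [mean_add hu, mean_const hu, mul_add, ← mean_const_mul]
    have h1 := mean_mono hu fun u _ => ih (x - η • averageUpdate u)
    rw [mean_add hu, mean_const hu] at h1
    have h2 := mean_norm_step_sq_le hK hl hL hsc hc hf hxs hη y x
    push_cast
    linarith

theorem length_of_mem_support_iterationsLaw {η : ℝ} {y : Vec n} {T : ℕ} {x : Vec n}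
    {r : List (Vec n × (Fin K → Quantized n))}
    (hr : r ∈ (iterationsLaw f K η y T x).support) : r.length = T := by
  induction T generalizing x r with
  | zero => simpa [iterationsLaw] using hr
  | succ T ih =>
    simp only [iterationsLaw, PMF.mem_support_bind_iff, PMF.mem_support_map_iff] at hr
    obtain ⟨u, -, r', hr', rfl⟩ := hr
    rw [List.length_cons, ih hr']

theorem mean_epochLaw_objective_le (hK : 0 < K) (hl : 0 < l) (hL : 0 < L)
    (hsc : StronglyConvex l (objective f)) (hc : ∀ j, ConvexOn ℝ Set.univ (f j))
    (hf : ∀ j, Smooth L (f j)) (hxs : gradient (objective f) xs = 0) {η : ℝ} {T : ℕ}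
    (hη : 0 < η) (hηL : η * L ≤ 1 / 1000) (hT : 2 / l ≤ η * T) (y : Vec n) :
    mean (epochLaw f K η T y) (fun r => objective f r.next) ≤
      objective f xs + 0.9 * (objective f y - objective f xs) := by
  have hTpos : (0 : ℝ) < T := pos_of_mul_pos_right ((div_pos two_pos hl).trans_le hT) hη.le
  have hT0 : T ≠ 0 := by
    rintro rfl
    simp at hTpos
  have hit := finite_support_iterationsLaw f K η T y y
  rw [mean_epochLaw]
  have hr : ∀ r ∈ (iterationsLaw f K η y T y).support,
      objective f (EpochRecord.next ⟨y, r⟩) ≤ objective f xs +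
        1 / (T : ℝ) * (r.map fun e => objective f e.1 - objective f xs).sum := by
    intro r hr
    have hlen := length_of_mem_support_iterationsLaw hr
    have hne : r.map Prod.fst ≠ [] := by
      intro h
      apply hT0
      rw [← hlen, ← List.length_map (f := Prod.fst), h, List.length_nil]
    have hj := hsc.average_le hl.le hne
    have hs : (r.map fun e => objective f e.1 - objective f xs).sum =
        ((r.map Prod.fst).map (objective f)).sum - T * objective f xs := by
      rw [← hlen, List.map_map]
      clear hr hne hj hlen
      induction r with
      | nil => simp
      | cons a r ih =>
        simp only [List.map_cons, List.sum_cons, List.length_cons, ih, Function.comp_apply]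
        push_cast
        ring
    rw [List.length_map, hlen] at hj
    rw [hs, EpochRecord.next, hlen, mul_sub, ← mul_assoc, one_div_mul_cancel hTpos.ne', one_mul,
      add_sub_cancel, one_div_mul_eq_div, le_div_iff₀' hTpos]
    exact hj
  refine (mean_mono hit hr).trans ?_
  rw [mean_add hit, mean_const hit, mean_const_mul, one_div_mul_eq_div]
  gcongr
  rw [div_le_iff₀ hTpos]
  have hΔ := hsc.norm_sub_sq_le hxs y
  set Δ := objective f y - objective f xs
  have hsum := mean_sum_suboptimality_le hK hl.le hL hsc hc hf hxs hη.le y T y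
  set S := mean (iterationsLaw f K η y T y)
    (fun r => (r.map fun e => objective f e.1 - objective f xs).sum)
  have hΔ0 : 0 ≤ Δ := le_trans (by positivity) hΔ
  have hdist : ‖y - xs‖ ^ 2 ≤ η * T * Δ :=
    calc _ = 2 / l * (l / 2 * ‖y - xs‖ ^ 2) := by field_simp
      _ ≤ 2 / l * Δ := by gcongr
      _ ≤ η * T * Δ := by gcongr
  have ha : 2 * η - 24 * L * η ^ 2 = η * (2 - 24 * (η * L)) := by ring
  have hpos : 0 < 2 - 24 * (η * L) := by linarith
  rw [ha, mul_assoc] at hsum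
  have h1 : η * ((2 - 24 * (η * L)) * S) ≤ η * ((1 + 48 * (η * L)) * (T * Δ)) :=
    hsum.trans (by linarith)
  have h2 := le_of_mul_le_mul_left h1 hη
  -- For `η L ≤ 1 / 1000` the ratio `(1 + 48 η L) / (2 - 24 η L)` is at most `1.048 / 1.976`, well
  -- below `0.9`.
  have h3 : (2 - 24 * (η * L)) * S ≤ (2 - 24 * (η * L)) * (0.9 * Δ * T) :=
    h2.trans (by nlinarith [mul_nonneg hTpos.le hΔ0])
  exact le_of_mul_le_mul_left h3 hpos

theorem mean_pointLaw_objective_le (hK : 0 < K) (hl : 0 < l) (hL : 0 < L)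
    (hsc : StronglyConvex l (objective f)) (hc : ∀ j, ConvexOn ℝ Set.univ (f j))
    (hf : ∀ j, Smooth L (f j)) (hxs : gradient (objective f) xs = 0) {η : ℝ} {T : ℕ}
    (hη : 0 < η) (hηL : η * L ≤ 1 / 1000) (hT : 2 / l ≤ η * T) (y₁ : Vec n) (p : ℕ) :
    mean (pointLaw f K η T y₁ p) (objective f) - objective f xs ≤
      0.9 ^ p * (objective f y₁ - objective f xs) := by
  induction p with
  | zero => simp [pointLaw, mean_pure]
  | succ p ih =>
    have hp := finite_support_pointLaw f K η T y₁ p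
    have he := finite_support_epochLaw f K η T
    rw [pointLaw, mean_bind hp fun y => finite_support_map (he y) _]
    simp_rw [mean_map (he _)]
    have h := mean_mono hp fun y _ =>
      mean_epochLaw_objective_le hK hl hL hsc hc hf hxs hη hηL hT y
    simp_rw [sub_eq_add_neg] at h
    rw [mean_add hp, mean_const hp, mean_const_mul, mean_add hp, mean_const hp] at h
    rw [pow_succ]
    linarith

end Convergence

end QSVRG

/-! ### Choice of the constants and the code -/

theorem theorem3p6 :
    -- convergence
    (∃ c₀ : ℝ, 0 < c₀ ∧ ∀ c : ℝ, 0 < c → c ≤ c₀ → ∃ C : ℝ, 0 < C ∧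
      ∀ (n m K : ℕ) [NeZero m] (_ : 0 < K) (f : Fin m → QSVRG.Vec n → ℝ) (l L : ℝ),
        0 < l → 0 < L →
        QSVRG.StronglyConvex l (QSVRG.objective f) →
        (∀ j, ConvexOn ℝ Set.univ (f j)) →
        (∀ j, QSVRG.Smooth L (f j)) →
        ∀ xs : QSVRG.Vec n, (∀ x, QSVRG.objective f xs ≤ QSVRG.objective f x) →
        ∀ (η : ℝ) (T : ℕ), c / L ≤ η → η ≤ c₀ / L → C * (L / l) ≤ T →
        ∀ (y₁ : QSVRG.Vec n) (p : ℕ),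
          QSVRG.FiniteMean (QSVRG.pointLaw f K η T y₁ p) (QSVRG.objective f) ∧
          QSVRG.mean (QSVRG.pointLaw f K η T y₁ p) (QSVRG.objective f) - QSVRG.objective f xs
            ≤ 0.9 ^ p * (QSVRG.objective f y₁ - QSVRG.objective f xs)) ∧
    -- communication, for each processor `i` and each epoch `p + 1`
    (∀ n : ℕ, ∃ code : QSVRG.PrefixCode n,
      ∀ (m K : ℕ) [NeZero m] (f : Fin m → QSVRG.Vec n → ℝ) (η : ℝ) (T F : ℕ)
        (y₁ : QSVRG.Vec n) (p : ℕ) (i : Fin K),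
          QSVRG.FiniteMean (QSVRG.epochRecordLaw f K η T y₁ p)
            (fun r => (QSVRG.epochBits F code f K i r : ℝ)) ∧
          QSVRG.mean (QSVRG.epochRecordLaw f K η T y₁ p)
            (fun r => (QSVRG.epochBits F code f K i r : ℝ))
            ≤ ((F : ℝ) + 2.8 * n) * ((T : ℝ) + 1) + (F : ℝ) * n) := by
  -- `C = 2 / c` is what makes `η T ≥ (c / L) (C L / l) = 2 / l`, so that the initial squared
  -- distance is at most `η T` times the initial suboptimality.
  refine ⟨⟨1 / 1000, by norm_num, fun c hc _ => ⟨2 / c, by positivity, ?_⟩⟩, fun n =>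
    ⟨QSVRG.wordCode n, ?_⟩⟩
  · intro n m K _ hK f l L hl hL hsc hconv hf xs hxs η T hη1 hη2 hT y₁ p
    refine ⟨QSVRG.finiteMean_of_finite (QSVRG.finite_support_pointLaw f K η T y₁ p) _, ?_⟩
    have hη : 0 < η := (div_pos hc hL).trans_le hη1
    refine QSVRG.mean_pointLaw_objective_le hK hl hL hsc hconv hf
      (QSVRG.gradient_eq_zero_of_forall_le hxs) hη
      ((le_div_iff₀ hL).1 hη2) ?_ y₁ p
    calc 2 / l = c / L * (2 / c * (L / l)) := by field_simp
      _ ≤ η * T := by gcongr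
  · intro m K _ f η T F y₁ p i
    refine ⟨QSVRG.finiteMean_of_finite (QSVRG.finite_support_epochRecordLaw f K η T y₁ p) _,
      (QSVRG.mean_epochBits_le f K η T F y₁ p i).trans ?_⟩
    have hF : (0 : ℝ) ≤ F := F.cast_nonneg
    have hn : (0 : ℝ) ≤ n := n.cast_nonneg
    have hT : (0 : ℝ) ≤ T := T.cast_nonneg
    -- The slack is `F + 2.8 n + 0.3 n T`.
    nlinarith [mul_nonneg hn hT]
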